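/- Let $p\ge 1$, let $\mu\in\mathbb R^d$, let $A_1,\dots,A_p$ be real $d\times d$ matrices, let $\Sigma$ be a positive definite $d\times d$ matrix, and let $(Z_t)_{t\in\mathbb Z}$ be independent $\mathrm N_d(0,\Sigma)$ random vectors. Let $(X_t)_{t\in\mathbb Z}$ be a stationary (all joint distributions are invariant under time shifts), square-integrable $\mathbb R^d$-valued process with $$X_t=\mu+A_1X_{t-1}+\cdots+A_pX_{t-p}+Z_t\quad\text{almost surely, for all } t\in\mathbb Z,$$ and with variance matrix $\mathrm{Var}(X_t)=\Omega^{-1}$, where $\Omega$ is positive definite. For $j\ge 1$ let $C_j=\mathrm{Var}(X_{j+1}\mid X_j,\dots,X_1)$ be the conditional variance matrix. Then the process is causal, that is, every root $z\in\mathbb C$ of $\det(I-A_1z-\cdots-A_pz^p)=0$ satisfies $|z|>1$, if and only if, almost surely, $$\Omega\le C_1^{-1}\le\cdots\le C_p^{-1}=\Sigma^{-1},$$ where $M\le N$ means that $N-M$ is nonnegative definite. -/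

import Mathlib

open MeasureTheory ProbabilityTheory
open scoped MatrixOrder

noncomputable section

/-- The law of the whole path `(X_t)_{t ∈ ℤ}` is invariant under every time shift. -/
def IsStationaryProcess {S E : Type*} [MeasurableSpace S] [MeasurableSpace E]
    (P : Measure S) (X : ℤ → S → E) : Prop :=
  ∀ h : ℤ, P.map (fun ω t => X (t + h) ω) = P.map (fun ω t => X t ω)

/-- `Z` is a sequence of independent `N(0, Sig)` random vectors. -/
structure IsGaussianWhiteNoise {S : Type*} [MeasurableSpace S] {d : ℕ}
    (P : Measure S) (Sig : Matrix (Fin d) (Fin d) ℝ)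
    (Z : ℤ → S → EuclideanSpace ℝ (Fin d)) : Prop where
  measurable : ∀ t, Measurable (Z t)
  law : ∀ t, P.map (Z t) = multivariateGaussian 0 Sig
  indep : iIndepFun Z P

/-- `X_t = c + A_1 X_{t-1} + ⋯ + A_p X_{t-p} + Z_t` almost surely, for every `t ∈ ℤ`;
the coefficient `A_{i+1}` is `A i` for `i = 0, …, p - 1`. -/
def SatisfiesVAR {S : Type*} [MeasurableSpace S] {d p : ℕ}
    (P : Measure S) (c : EuclideanSpace ℝ (Fin d)) (A : Fin p → Matrix (Fin d) (Fin d) ℝ)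
    (X Z : ℤ → S → EuclideanSpace ℝ (Fin d)) : Prop :=
  ∀ t : ℤ, ∀ᵐ ω ∂P,
    X t ω = c + ∑ i : Fin p,
      Matrix.toEuclideanCLM (𝕜 := ℝ) (A i) (X (t - ((i : ℕ) + 1 : ℤ)) ω) + Z t ω

/-- The matrix polynomial `A(z) = I - A_1 z - ⋯ - A_p z^p`, `z ∈ ℂ`. -/
def varPolynomial {d p : ℕ} (A : Fin p → Matrix (Fin d) (Fin d) ℝ) (z : ℂ) :
    Matrix (Fin d) (Fin d) ℂ :=
  1 - ∑ i : Fin p, z ^ ((i : ℕ) + 1) • (A i).map (fun x : ℝ => (x : ℂ))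

/-- Causality: all roots of `det A(z) = 0` lie outside the closed unit disc. -/
def IsCausalVAR {d p : ℕ} (A : Fin p → Matrix (Fin d) (Fin d) ℝ) : Prop :=
  ∀ z : ℂ, (varPolynomial A z).det = 0 → 1 < ‖z‖

/-- The variance (dispersion) matrix of a random vector. -/
def varMatrix {S : Type*} [MeasurableSpace S] {d : ℕ}
    (P : Measure S) (Y : S → EuclideanSpace ℝ (Fin d)) : Matrix (Fin d) (Fin d) ℝ :=
  Matrix.of fun a b => cov[fun ω => Y ω a, fun ω => Y ω b; P]

/-- The conditional variance matrix
`E[(Y - E[Y | m]) (Y - E[Y | m])ᵀ | m]` of a random vector given a σ-algebra `m`. -/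
def condVarMatrix {S : Type*} [MeasurableSpace S] {d : ℕ}
    (P : Measure S) (m : MeasurableSpace S) (Y : S → EuclideanSpace ℝ (Fin d)) (ω : S) :
    Matrix (Fin d) (Fin d) ℝ :=
  Matrix.of fun a b =>
    (P[fun ω' => (Y ω' a - (P[fun η => Y η a | m]) ω') *
      (Y ω' b - (P[fun η => Y η b | m]) ω') | m]) ω

/-- The σ-algebra generated by `X_1, …, X_j`. -/
abbrev obsSigma {S E : Type*} [MeasurableSpace E] (X : ℤ → S → E) (j : ℕ) : MeasurableSpace S :=
  MeasurableSpace.comap (fun (ω : S) (i : Fin j) => X ((i : ℕ) + 1 : ℤ) ω) inferInstance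

/-- `C_j = Var(X_{j+1} | X_j, …, X_1)`. -/
def condDispersion {S : Type*} [MeasurableSpace S] {d : ℕ}
    (P : Measure S) (X : ℤ → S → EuclideanSpace ℝ (Fin d)) (j : ℕ) (ω : S) :
    Matrix (Fin d) (Fin d) ℝ :=
  condVarMatrix P (obsSigma X j) (X ((j : ℤ) + 1)) ω

end

open Filter Topology
open scoped Matrix RealInnerProductSpace

/-! The centred coordinates of `X` and the innovations are treated as vectors `x t a`, `z t a` of
the Hilbert space `L²(P)`, where stationarity becomes shift invariance of the Gram matrix.

Causality gives the chain. The powers of the companion operator tend to zero, so a bounded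
homogeneous solution on a left half-line vanishes. Applied to `⟪x t a, h⟫`, this shows that whatever
is orthogonal to the innovations up to time `T` is orthogonal to the values up to `T`
(`IsCausalVAR.inner_eq_zero`). Hence `x` lies in the closed span of the noise, so it is a Gaussian
family, and `C_j` is almost surely the Gram matrix of the linear prediction errors. These matrices
decrease in `j` by stationarity, start at `Om⁻¹` for `j = 0`, and reach `Sig` at `j = p`, because
the innovation is then the prediction error. Inversion reverses the order.

Conversely, only `C_p = Sig` is needed. By the law of total variance it makes the innovation
orthogonal to the `p` preceding values (`integral_mul_eq_zero_of_condVar_eq`), without any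
Gaussianity of `X`. A root `w` with `‖w‖ ≤ 1` then contradicts Pythagoras and stationarity
(`isCausalVAR_of_inner_eq_zero`). -/

/-- In a complex Banach algebra, the powers of an element whose spectrum lies in the open unit
disc tend to `0`. -/
theorem tendsto_pow_zero_of_spectrum {R : Type*} [NormedRing R] [NormedAlgebra ℂ R]
    [CompleteSpace R] [Nontrivial R] (a : R) (h : ∀ l ∈ spectrum ℂ a, ‖l‖ < 1) :
    Tendsto (fun n : ℕ => a ^ n) atTop (𝓝 0) := by
  have hr : spectralRadius ℂ a < 1 := by
    have := spectrum.spectralRadius_lt_of_forall_lt a (r := 1) (fun z hz => by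
      have := h z hz
      exact_mod_cast this)
    simpa using this
  obtain ⟨r, hr1, hr2⟩ := ENNReal.lt_iff_exists_nnreal_btwn.1 hr
  have hr2' : r < 1 := by exact_mod_cast hr2
  -- Gelfand's formula: eventually `‖a ^ n‖ ≤ r ^ n` for some `r < 1`.
  have hev := (spectrum.pow_nnnorm_pow_one_div_tendsto_nhds_spectralRadius a).eventually_lt_const hr1
  refine squeeze_zero_norm' (a := fun n : ℕ => (r : ℝ) ^ n) ?_
    (tendsto_pow_atTop_nhds_zero_of_lt_one r.2 (by exact_mod_cast hr2'))
  filter_upwards [hev, eventually_gt_atTop 0] with n hn hn0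
  have h1 : (‖a ^ n‖₊ : ENNReal) ≤ (r : ENNReal) ^ n := by
    have h2 := ENNReal.rpow_le_rpow hn.le (z := (n : ℝ)) (by positivity)
    rwa [← ENNReal.rpow_mul, one_div, inv_mul_cancel₀ (by positivity), ENNReal.rpow_one,
      ENNReal.rpow_natCast] at h2
  have h3 : ‖a ^ n‖₊ ≤ r ^ n := by exact_mod_cast h1
  exact_mod_cast h3

/-! ### Companion operator and bounded solutions of the recursion -/

section Companion

variable {d q : ℕ}

/-- The companion operator of the matrix recursion `y_t = A_1 y_{t-1} + ⋯ + A_p y_{t-p}`, acting on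
the stacked vector `(y_{t-1}, …, y_{t-p})`. -/
noncomputable def companionMap (A : Fin (q + 1) → Matrix (Fin d) (Fin d) ℝ) :
    Module.End ℂ (Fin (q + 1) → Fin d → ℂ) :=
  LinearMap.pi (Fin.cons
    (∑ i, (Matrix.mulVecLin ((A i).map (fun x : ℝ => (x : ℂ)))) ∘ₗ LinearMap.proj i)
    (fun k : Fin q => LinearMap.proj k.castSucc))

theorem companionMap_apply_zero (A : Fin (q + 1) → Matrix (Fin d) (Fin d) ℝ)
    (x : Fin (q + 1) → Fin d → ℂ) :
    companionMap A x 0 = ∑ i, (A i).map (fun x : ℝ => (x : ℂ)) *ᵥ x i := by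
  simp [companionMap, LinearMap.sum_apply]

theorem companionMap_apply_succ (A : Fin (q + 1) → Matrix (Fin d) (Fin d) ℝ)
    (x : Fin (q + 1) → Fin d → ℂ) (k : Fin q) :
    companionMap A x k.succ = x k.castSucc := by
  simp [companionMap]

/-- The shift rows force an eigenvector for `l ≠ 0` to have blocks `x k = l⁻¹ ^ k • x 0`; the top
row then says that `x 0` is in the kernel of `varPolynomial A l⁻¹`, so `l⁻¹` is a root. -/
theorem IsCausalVAR.norm_eigenvalue_lt_one {A : Fin (q + 1) → Matrix (Fin d) (Fin d) ℝ}
    (hA : IsCausalVAR A) {l : ℂ} (hl : Module.End.HasEigenvalue (companionMap A) l) : ‖l‖ < 1 := by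
  by_cases hl0 : l = 0
  · simp [hl0]
  obtain ⟨x, hx⟩ := hl.exists_hasEigenvector
  have hxe : companionMap A x = l • x := hx.apply_eq_smul
  have hk : ∀ k : ℕ, ∀ hk : k < q + 1, x ⟨k, hk⟩ = l⁻¹ ^ k • x 0 := by
    intro k
    induction k with
    | zero => intro hk; simp
    | succ k ih =>
      intro hk
      have h1 := congrFun hxe (Fin.succ ⟨k, by omega⟩)
      rw [companionMap_apply_succ] at h1
      have h2 := ih (by omega)
      have h3 : l • x ⟨k + 1, hk⟩ = l⁻¹ ^ k • x 0 := by
        rw [← h2]; exact h1.symm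
      rw [pow_succ', mul_smul, ← h3, smul_smul, inv_mul_cancel₀ hl0, one_smul]
  have hx0 : x 0 ≠ 0 := by
    intro h0
    apply hx.2
    ext1 k
    have := hk k k.2
    simpa [h0] using this
  have h0 := congrFun hxe 0
  rw [companionMap_apply_zero] at h0
  have hdet : (varPolynomial A l⁻¹).det = 0 := by
    refine Matrix.exists_mulVec_eq_zero_iff.1 ⟨x 0, hx0, ?_⟩
    rw [varPolynomial, Matrix.sub_mulVec, Matrix.one_mulVec, sub_eq_zero, Matrix.sum_mulVec]
    have h1 : x 0 = l⁻¹ • (l • x 0) := by rw [smul_smul, inv_mul_cancel₀ hl0, one_smul]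
    have h2 : l • x 0 = (l • x) 0 := rfl
    rw [h2, ← h0, Finset.smul_sum] at h1
    refine h1.trans (Finset.sum_congr rfl fun i _ => ?_)
    have h3 := hk i i.2
    rw [Fin.eta] at h3
    rw [h3, Matrix.mulVec_smul, smul_smul, Matrix.smul_mulVec, pow_succ']
  have := hA _ hdet
  rw [norm_inv] at this
  exact (one_lt_inv₀ (norm_pos_iff.2 hl0)).1 this

theorem IsCausalVAR.tendsto_companionMap_pow {A : Fin (q + 1) → Matrix (Fin d) (Fin d) ℝ}
    (hA : IsCausalVAR A) :
    Tendsto (fun n : ℕ => (LinearMap.toContinuousLinearMap (companionMap A)) ^ n) atTop (𝓝 0) := by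
  rcases subsingleton_or_nontrivial (Fin (q + 1) → Fin d → ℂ) with hs | hs
  · have : Subsingleton ((Fin (q + 1) → Fin d → ℂ) →L[ℂ] (Fin (q + 1) → Fin d → ℂ)) :=
      ⟨fun f g => by ext1 x; exact Subsingleton.elim _ _⟩
    refine tendsto_const_nhds.congr fun n => Subsingleton.elim _ _
  · refine tendsto_pow_zero_of_spectrum _ fun l hl => hA.norm_eigenvalue_lt_one ?_
    rw [Module.End.hasEigenvalue_iff_mem_spectrum]
    have := AlgEquiv.spectrum_eq (Module.End.toContinuousLinearMap (𝕜 := ℂ)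
      (Fin (q + 1) → Fin d → ℂ)) (companionMap A)
    rw [← this]
    exact hl

/-- For a causal recursion, the only solution on `(-∞, T]` that is bounded is `0`. -/
theorem IsCausalVAR.eq_zero_of_bounded {A : Fin (q + 1) → Matrix (Fin d) (Fin d) ℝ}
    (hA : IsCausalVAR A) {y : ℤ → Fin d → ℝ} {C : ℝ} (hC : ∀ t a, |y t a| ≤ C) {T : ℤ}
    (hy : ∀ t ≤ T, ∀ a, y t a = ∑ i : Fin (q + 1), ∑ b, A i a b * y (t - ((i : ℕ) + 1 : ℤ)) b)
    {t : ℤ} (ht : t ≤ T) (a : Fin d) : y t a = 0 := by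
  set F := LinearMap.toContinuousLinearMap (companionMap A) with hF
  -- The stacked state `(y_s, …, y_{s-q})` satisfies `Y s = F (Y (s - 1))`, hence `Y t = F ^ n (Y (t
  -- - n))` with `Y` bounded and `F ^ n → 0`.
  let Y : ℤ → Fin (q + 1) → Fin d → ℂ := fun s k b => (y (s - (k : ℕ)) b : ℂ)
  have hstep : ∀ s ≤ T, Y s = F (Y (s - 1)) := by
    intro s hs
    ext k b
    change Y s k b = companionMap A (Y (s - 1)) k b
    induction k using Fin.cases with
    | zero =>
      rw [companionMap_apply_zero]
      simp only [Y, Finset.sum_apply, Matrix.mulVec, dotProduct, Matrix.map_apply]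
      rw [Fin.val_zero, Nat.cast_zero, sub_zero, hy s hs b]
      push_cast
      refine Finset.sum_congr rfl fun i _ => Finset.sum_congr rfl fun c _ => ?_
      rw [show s - ((i : ℕ) + 1 : ℤ) = s - 1 - ((i : ℕ) : ℤ) by ring]
    | succ k =>
      rw [companionMap_apply_succ]
      simp only [Y, Fin.val_succ, Fin.val_castSucc]
      congr 2
      push_cast
      ring
  have hpow : ∀ n : ℕ, Y t = (F ^ n) (Y (t - n)) := by
    intro n
    induction n with
    | zero => simp
    | succ n ih =>
      rw [ih, pow_succ, mul_apply_eq_comp, hstep (t - n) (by omega)]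
      congr 3
      push_cast; ring
  have hC0 : 0 ≤ C := (abs_nonneg _).trans (hC 0 a)
  have hYb : ∀ s, ‖Y s‖ ≤ C := fun s =>
    (pi_norm_le_iff_of_nonneg hC0).2 fun k => (pi_norm_le_iff_of_nonneg hC0).2 fun b => by
      simpa [Y] using hC (s - (k : ℕ)) b
  have hYt : Y t = 0 := by
    rw [← norm_eq_zero]
    refine le_antisymm ?_ (norm_nonneg _)
    have hlim : Tendsto (fun n : ℕ => ‖F ^ n‖ * C) atTop (𝓝 (‖(0 : _ →L[ℂ] _)‖ * C)) :=
      (hA.tendsto_companionMap_pow.norm).mul_const C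
    rw [norm_zero, zero_mul] at hlim
    refine ge_of_tendsto' hlim fun n => ?_
    rw [hpow n]
    exact ((F ^ n).le_opNorm _).trans (by gcongr; exact hYb _)
  have := congrFun (congrFun hYt 0) a
  simpa [Y] using this

end Companion

/-! ### Causality versus orthogonality of innovations, in a Hilbert space setting -/

section Hilbert

variable {H : Type*} [NormedAddCommGroup H] [InnerProductSpace ℝ H] {d : ℕ}

/-- Two families with the same Gram matrix have linear combinations of the same norm. -/
theorem norm_sum_smul_eq_of_gram_eq {ι : Type*} [Fintype ι] {f g : ι → H}
    (h : ∀ i j, ⟪f i, f j⟫ = ⟪g i, g j⟫) (c : ι → ℝ) :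
    ‖∑ i, c i • f i‖ = ‖∑ i, c i • g i‖ := by
  have : ‖∑ i, c i • f i‖ ^ 2 = ‖∑ i, c i • g i‖ ^ 2 := by
    simp only [← real_inner_self_eq_norm_sq, sum_inner, inner_sum, inner_smul_left,
      inner_smul_right, h]
  exact (pow_left_inj₀ (norm_nonneg _) (norm_nonneg _) two_ne_zero).1 this

theorem Matrix.PosDef.eq_zero_of_sum_smul_eq_zero {Sig : Matrix (Fin d) (Fin d) ℝ} (hSig : Sig.PosDef)
    {z : Fin d → H} (hz : ∀ a b, ⟪z a, z b⟫ = Sig a b) {c : Fin d → ℝ}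
    (hc : ∑ a, c a • z a = 0) : c = 0 := by
  by_contra h
  have h1 := hSig.dotProduct_mulVec_pos h
  have h2 : star c ⬝ᵥ Sig *ᵥ c = ⟪∑ a, c a • z a, ∑ a, c a • z a⟫ := by
    simp only [sum_inner, inner_sum, inner_smul_left, inner_smul_right, hz, dotProduct,
      Matrix.mulVec, Finset.mul_sum]
    refine Finset.sum_congr rfl fun a _ => Finset.sum_congr rfl fun b _ => ?_
    rw [← hz b a, real_inner_comm, hz]
    simp [mul_comm]
  rw [h2, hc, inner_zero_left] at h1
  exact lt_irrefl _ h1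

/-- A stationary solution of a vector autoregression whose innovations are orthogonal to the `p`
preceding values is causal. -/
theorem isCausalVAR_of_inner_eq_zero {q : ℕ} {A : Fin (q + 1) → Matrix (Fin d) (Fin d) ℝ}
    {Sig : Matrix (Fin d) (Fin d) ℝ} (hSig : Sig.PosDef) {x z : ℤ → Fin d → H}
    (hrec : ∀ t a, x t a = ∑ i : Fin (q + 1), ∑ b, A i a b • x (t - ((i : ℕ) + 1 : ℤ)) b + z t a)
    (hst : ∀ s t a b, ⟪x (s + 1) a, x (t + 1) b⟫ = ⟪x s a, x t b⟫)
    (hz : ∀ t a b, ⟪z t a, z t b⟫ = Sig a b)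
    (hort : ∀ t a (i : Fin (q + 1)) b, ⟪z t a, x (t - ((i : ℕ) + 1 : ℤ)) b⟫ = 0) :
    IsCausalVAR A := by
  intro w hw
  by_contra hw1
  rw [not_lt] at hw1
  -- With `u` a left null vector of `A(w)`, the Horner remainders `R k` give a scalar process `S_t =
  -- ∑ R_k x_{t-k}` with `w S_t = S_{t-1} + u z_t`. The two terms on the right are orthogonal and
  -- `‖S_t‖` is constant, so `‖w‖² ‖S‖² = ‖S‖² + ‖u z_t‖²`; if `‖w‖ ≤ 1`, then `u z_t = 0`. The
  -- default value `0` of `uA` is never read.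
  obtain ⟨u, hu0, hu⟩ := Matrix.exists_vecMul_eq_zero_iff.2 hw
  let uA : ℕ → Fin d → ℂ := fun k =>
    if h : k < q + 1 then u ᵥ* (A ⟨k, h⟩).map (fun x : ℝ => (x : ℂ)) else 0
  let R : ℕ → Fin d → ℂ := fun k => ∑ i ∈ Finset.range (q + 1 - k), w ^ i • uA (k + i)
  have hRq : R (q + 1) = 0 := by simp [R]
  have hR : ∀ k, k < q + 1 → R k = uA k + w • R (k + 1) := by
    intro k hk
    simp only [R]
    rw [show q + 1 - k = (q + 1 - (k + 1)) + 1 by omega, Finset.sum_range_succ', add_comm,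
      Finset.smul_sum]
    congr 1
    · simp
    · refine Finset.sum_congr rfl fun i _ => ?_
      rw [smul_smul, pow_succ', add_right_comm, add_assoc]
  have huR : u = w • R 0 := by
    rw [varPolynomial, Matrix.vecMul_sub, Matrix.vecMul_one, sub_eq_zero, Matrix.vecMul_sum] at hu
    refine hu.trans ?_
    simp only [R, tsub_zero, Finset.smul_sum, zero_add]
    rw [Finset.sum_range]
    refine Finset.sum_congr rfl fun i _ => ?_
    simp only [uA, i.2, dite_true, Fin.eta, Matrix.vecMul_smul, smul_smul, pow_succ']
  have hua : ∀ a, u a = w * R 0 a := fun a => congrFun huR a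
  -- for a real linear functional `l` on `ℂ`, the combination `∑ l (R_k) x_{t-k}`
  let comb : (ℂ →ₗ[ℝ] ℝ) → (ℕ → Fin d → ℂ) → ℤ → H := fun l c t =>
    ∑ k : Fin (q + 1), ∑ b, l (c k b) • x (t - (k : ℕ)) b
  have hstep : ∀ (l : ℂ →ₗ[ℝ] ℝ) t, comb l (fun k => w • R k) t =
      comb l R (t - 1) + ∑ a, l (u a) • z t a := by
    intro l t
    have h1 : comb l (fun k => w • R k) t = ∑ a, l (u a) • x t a +
        ∑ k : Fin q, ∑ b, l ((w • R (k + 1)) b) • x (t - 1 - (k : ℕ)) b := by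
      simp only [comb]
      rw [Fin.sum_univ_succ]
      congr 1
      · simp [hua]
      · refine Finset.sum_congr rfl fun k _ => Finset.sum_congr rfl fun b _ => ?_
        rw [Fin.val_succ]
        congr 2
        push_cast; ring
    have h2 : comb l R (t - 1) =
        ∑ k : Fin (q + 1), ∑ b, l (uA k b) • x (t - 1 - (k : ℕ)) b +
        ∑ k : Fin q, ∑ b, l ((w • R (k + 1)) b) • x (t - 1 - (k : ℕ)) b := by
      have h3 : ∑ k : Fin q, ∑ b, l ((w • R (k + 1)) b) • x (t - 1 - (k : ℕ)) b =
          ∑ k : Fin (q + 1), ∑ b, l ((w • R (k + 1)) b) • x (t - 1 - (k : ℕ)) b := by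
        rw [Fin.sum_univ_castSucc]
        simp [hRq]
      rw [h3, ← Finset.sum_add_distrib]
      refine Finset.sum_congr rfl fun k _ => ?_
      rw [← Finset.sum_add_distrib]
      refine Finset.sum_congr rfl fun b _ => ?_
      rw [hR k k.2, Pi.add_apply, map_add, add_smul]
    have h4 : ∑ a, l (u a) • x t a =
        ∑ k : Fin (q + 1), ∑ b, l (uA k b) • x (t - 1 - (k : ℕ)) b + ∑ a, l (u a) • z t a := by
      simp only [hrec t, smul_add, Finset.sum_add_distrib, Finset.smul_sum]
      congr 1
      rw [Finset.sum_comm]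
      refine Finset.sum_congr rfl fun k _ => ?_
      rw [Finset.sum_comm]
      refine Finset.sum_congr rfl fun b _ => ?_
      have h5 : uA k b = ∑ a, A k a b • u a := by
        simp only [uA, k.2, dite_true, Fin.eta, Matrix.vecMul, dotProduct, Matrix.map_apply,
          Complex.real_smul]
        exact Finset.sum_congr rfl fun a _ => mul_comm _ _
      rw [h5, map_sum, Finset.sum_smul]
      refine Finset.sum_congr rfl fun a _ => ?_
      rw [map_smul, smul_smul, smul_eq_mul, mul_comm,
        show t - ((k : ℕ) + 1 : ℤ) = t - 1 - (k : ℕ) by ring]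
    rw [h1, h2, h4]
    abel
  have hpyth : ∀ (l : ℂ →ₗ[ℝ] ℝ) t, ‖comb l (fun k => w • R k) t‖ ^ 2 =
      ‖comb l R (t - 1)‖ ^ 2 + ‖∑ a, l (u a) • z t a‖ ^ 2 := by
    intro l t
    rw [hstep, sq, sq, sq]
    refine norm_add_sq_eq_norm_sq_add_norm_sq_real ?_
    rw [real_inner_comm]
    simp only [comb, sum_inner, inner_sum, inner_smul_left, inner_smul_right]
    refine Finset.sum_eq_zero fun k _ => Finset.sum_eq_zero fun b _ =>
      mul_eq_zero_of_right _ (Finset.sum_eq_zero fun a _ => mul_eq_zero_of_right _ ?_)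
    rw [show t - 1 - (k : ℕ) = t - ((k : ℕ) + 1 : ℤ) by ring, hort]
  have hstat : ∀ (l : ℂ →ₗ[ℝ] ℝ) t, ‖comb l R (t - 1)‖ = ‖comb l R t‖ := by
    intro l t
    have := norm_sum_smul_eq_of_gram_eq (ι := Fin (q + 1) × Fin d)
      (f := fun i => x (t - 1 - (i.1 : ℕ)) i.2) (g := fun i => x (t - (i.1 : ℕ)) i.2)
      (fun i j => by
        rw [← hst (t - 1 - (i.1 : ℕ)) (t - 1 - (j.1 : ℕ))]
        congr 2 <;> ring) (fun i => l (R i.1 i.2))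
    simpa only [comb, Fintype.sum_prod_type] using this
  have hre : comb Complex.reLm (fun k => w • R k) 0 =
      w.re • comb Complex.reLm R 0 - w.im • comb Complex.imLm R 0 := by
    simp only [comb, Finset.smul_sum, ← Finset.sum_sub_distrib]
    refine Finset.sum_congr rfl fun k _ => Finset.sum_congr rfl fun b _ => ?_
    simp [sub_smul, mul_smul]
  have him : comb Complex.imLm (fun k => w • R k) 0 =
      w.re • comb Complex.imLm R 0 + w.im • comb Complex.reLm R 0 := by
    simp only [comb, Finset.smul_sum, ← Finset.sum_add_distrib]
    refine Finset.sum_congr rfl fun k _ => Finset.sum_congr rfl fun b _ => ?_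
    simp [add_smul, mul_smul]
  -- `H` is real, so the complex identity is split into real and imaginary parts; multiplication by
  -- `w` mixes them, and only the sum of the two squared norms scales by `‖w‖ ^ 2`.
  have hsum : ‖comb Complex.reLm (fun k => w • R k) 0‖ ^ 2 +
      ‖comb Complex.imLm (fun k => w • R k) 0‖ ^ 2 =
      ‖w‖ ^ 2 * (‖comb Complex.reLm R 0‖ ^ 2 + ‖comb Complex.imLm R 0‖ ^ 2) := by
    rw [hre, him, norm_sub_sq_real, norm_add_sq_real, ← Complex.normSq_eq_norm_sq,
      Complex.normSq_apply]
    simp only [norm_smul, inner_smul_left, inner_smul_right, mul_pow, Real.norm_eq_abs, sq_abs,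
      conj_trivial, real_inner_comm (comb Complex.imLm R 0)]
    ring
  have h1 := hpyth Complex.reLm 0
  have h2 := hpyth Complex.imLm 0
  rw [hstat] at h1 h2
  have hw2 : ‖w‖ ^ 2 ≤ 1 := pow_le_one₀ (norm_nonneg _) hw1
  have h3 := mul_le_mul_of_nonneg_right hw2
    (add_nonneg (sq_nonneg ‖comb Complex.reLm R 0‖) (sq_nonneg ‖comb Complex.imLm R 0‖))
  have h4 : ‖∑ a, Complex.reLm (u a) • z 0 a‖ ^ 2 = 0 :=
    le_antisymm (by nlinarith [sq_nonneg ‖∑ a, Complex.imLm (u a) • z 0 a‖]) (sq_nonneg _)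
  have h5 : ‖∑ a, Complex.imLm (u a) • z 0 a‖ ^ 2 = 0 :=
    le_antisymm (by nlinarith [sq_nonneg ‖∑ a, Complex.reLm (u a) • z 0 a‖]) (sq_nonneg _)
  have h6 := hSig.eq_zero_of_sum_smul_eq_zero (hz 0) (norm_eq_zero.1 (pow_eq_zero_iff two_ne_zero |>.1 h4))
  have h7 := hSig.eq_zero_of_sum_smul_eq_zero (hz 0) (norm_eq_zero.1 (pow_eq_zero_iff two_ne_zero |>.1 h5))
  refine hu0 (funext fun a => Complex.ext ?_ ?_)
  · exact congrFun h6 a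
  · exact congrFun h7 a

/-- For a causal stationary solution, a vector orthogonal to the innovations up to time `T` is
orthogonal to the values up to time `T`. -/
theorem IsCausalVAR.inner_eq_zero {q : ℕ} {A : Fin (q + 1) → Matrix (Fin d) (Fin d) ℝ}
    (hA : IsCausalVAR A) {x z : ℤ → Fin d → H}
    (hrec : ∀ t a, x t a = ∑ i : Fin (q + 1), ∑ b, A i a b • x (t - ((i : ℕ) + 1 : ℤ)) b + z t a)
    {C : ℝ} (hC : ∀ t a, ‖x t a‖ ≤ C) {h : H} {T : ℤ}
    (hh : ∀ t ≤ T, ∀ a, ⟪z t a, h⟫ = 0) {t : ℤ} (ht : t ≤ T) (a : Fin d) : ⟪x t a, h⟫ = 0 := by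
  -- Pairing the recursion with `h` removes the noise term up to time `T`.
  refine hA.eq_zero_of_bounded (y := fun t a => ⟪x t a, h⟫) (C := C * ‖h‖) (T := T) ?_ ?_ ht a
  · intro t a
    exact (abs_real_inner_le_norm _ _).trans (by gcongr; exact hC t a)
  · intro s hs b
    rw [hrec s b, inner_add_left, hh s hs, add_zero]
    simp only [sum_inner, inner_smul_left, conj_trivial]

end Hilbert

/-! ### Inversion and the Loewner order -/

/-- Inversion is antitone on positive definite matrices. -/
theorem Matrix.PosDef.inv_le_inv_of_le {n : Type*} [Fintype n] [DecidableEq n] {M N : Matrix n n ℝ}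
    (hM : M.PosDef) (hMN : M ≤ N) : N⁻¹ ≤ M⁻¹ := by
  have hN : N.PosDef := by
    have := hM.add_posSemidef (Matrix.le_iff.1 hMN)
    simpa using this
  rw [Matrix.le_iff]
  refine Matrix.PosSemidef.of_dotProduct_mulVec_nonneg
    (hM.inv.isHermitian.sub hN.inv.isHermitian) fun v => ?_
  have hMdet : IsUnit M.det := (Matrix.isUnit_iff_isUnit_det _).1 hM.isUnit
  have hNdet : IsUnit N.det := (Matrix.isUnit_iff_isUnit_det _).1 hN.isUnit
  -- The identity behind the proof is `v ⬝ (M⁻¹ - N⁻¹) v = (w - y) ⬝ M (w - y) + y ⬝ (N - M) y`.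
  set w := M⁻¹ *ᵥ v with hw
  set y := N⁻¹ *ᵥ v with hy
  have hMw : M *ᵥ w = v := by rw [hw, Matrix.mulVec_mulVec, Matrix.mul_nonsing_inv _ hMdet,
    Matrix.one_mulVec]
  have hNy : N *ᵥ y = v := by rw [hy, Matrix.mulVec_mulVec, Matrix.mul_nonsing_inv _ hNdet,
    Matrix.one_mulVec]
  have h1 := hM.posSemidef.dotProduct_mulVec_nonneg (w - y)
  have h2 := (Matrix.le_iff.1 hMN).dotProduct_mulVec_nonneg y
  have hsymm : w ⬝ᵥ M *ᵥ y = y ⬝ᵥ v := by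
    rw [Matrix.dotProduct_mulVec, ← Matrix.mulVec_transpose,
      ← Matrix.conjTranspose_eq_transpose_of_trivial, hM.isHermitian.eq, hMw, dotProduct_comm]
  simp only [star_trivial] at h1 h2 ⊢
  rw [Matrix.sub_mulVec, dotProduct_sub, ← hw, ← hy]
  rw [Matrix.sub_mulVec, dotProduct_sub, hNy] at h2
  rw [Matrix.mulVec_sub, hMw, sub_dotProduct, dotProduct_sub, dotProduct_sub, hsymm] at h1
  rw [dotProduct_comm v w, dotProduct_comm v y]
  linarith

/-! ### Linear prediction errors and their Gram matrices -/

section Residual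

variable {H : Type*} [NormedAddCommGroup H] [InnerProductSpace ℝ H] {d : ℕ}

/-- The span of `x_1, …, x_j`. -/
abbrev pastSpan (x : ℤ → Fin d → H) (j : ℕ) : Submodule ℝ H :=
  Submodule.span ℝ (Set.range fun i : Fin j × Fin d => x ((i.1 : ℕ) + 1 : ℤ) i.2)

instance finiteDimensional_pastSpan (x : ℤ → Fin d → H) (j : ℕ) :
    FiniteDimensional ℝ (pastSpan x j) :=
  FiniteDimensional.span_of_finite ℝ (Set.finite_range _)

/-- The error of the best linear prediction of `x_{j+1}` from `x_1, …, x_j`. -/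
noncomputable def linResidual (x : ℤ → Fin d → H) (j : ℕ) (a : Fin d) : H :=
  x ((j : ℤ) + 1) a - (pastSpan x j).starProjection (x ((j : ℤ) + 1) a)

/-- The Gram matrix of the prediction errors. -/
noncomputable def residualGram (x : ℤ → Fin d → H) (j : ℕ) : Matrix (Fin d) (Fin d) ℝ :=
  Matrix.of fun a b => ⟪linResidual x j a, linResidual x j b⟫

theorem mem_pastSpan (x : ℤ → Fin d → H) {j : ℕ} (i : Fin j) (b : Fin d) :
    x ((i : ℕ) + 1 : ℤ) b ∈ pastSpan x j :=
  Submodule.subset_span ⟨(i, b), rfl⟩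

theorem inner_linResidual_of_mem (x : ℤ → Fin d → H) (j : ℕ) (a : Fin d) {y : H}
    (hy : y ∈ pastSpan x j) : ⟪linResidual x j a, y⟫ = 0 :=
  Submodule.starProjection_inner_eq_zero _ y hy

theorem linResidual_eq_of_mem_of_orthogonal (x : ℤ → Fin d → H) (j : ℕ) (a : Fin d) {y : H}
    (hy : x ((j : ℤ) + 1) a - y ∈ pastSpan x j) (hort : ∀ w ∈ pastSpan x j, ⟪y, w⟫ = 0) :
    linResidual x j a = y := by
  have := Submodule.eq_starProjection_of_mem_of_inner_eq_zero (K := pastSpan x j)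
    (u := x ((j : ℤ) + 1) a) hy (fun w hw => by simpa using hort w hw)
  rw [linResidual, this]
  abel

theorem residualGram_isHermitian (x : ℤ → Fin d → H) (j : ℕ) : (residualGram x j).IsHermitian := by
  ext a b
  simp [residualGram, real_inner_comm]

theorem dotProduct_residualGram_mulVec (x : ℤ → Fin d → H) (j : ℕ) (v : Fin d → ℝ) :
    v ⬝ᵥ residualGram x j *ᵥ v = ‖∑ a, v a • linResidual x j a‖ ^ 2 := by
  simp only [← real_inner_self_eq_norm_sq, sum_inner, inner_sum, inner_smul_left, inner_smul_right,
    dotProduct, Matrix.mulVec, Finset.mul_sum, residualGram, Matrix.of_apply, conj_trivial]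
  refine Finset.sum_congr rfl fun a _ => Finset.sum_congr rfl fun b _ => ?_
  rw [real_inner_comm]
  ring

/-- Minimality of the orthogonal projection: any other predictor changes the error by an element of
the past, which is orthogonal to the residual. -/
theorem norm_sum_linResidual_le (x : ℤ → Fin d → H) (j : ℕ) (v : Fin d → ℝ) {w : H}
    (hw : w ∈ pastSpan x j) :
    ‖∑ a, v a • linResidual x j a‖ ≤ ‖∑ a, v a • x ((j : ℤ) + 1) a - w‖ := by
  set r := ∑ a, v a • linResidual x j a with hr
  obtain ⟨u, hu, huw⟩ : ∃ u ∈ pastSpan x j, ∑ a, v a • x ((j : ℤ) + 1) a - w = r + u := by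
    refine ⟨∑ a, v a • (pastSpan x j).starProjection (x ((j : ℤ) + 1) a) - w,
      Submodule.sub_mem _ (Submodule.sum_mem _ fun a _ => Submodule.smul_mem _ _
        (Submodule.starProjection_apply_mem _ _)) hw, ?_⟩
    simp only [hr, linResidual, smul_sub, Finset.sum_sub_distrib]
    abel
  have hort : ⟪r, u⟫ = 0 := by
    simp only [hr, sum_inner, inner_smul_left, inner_linResidual_of_mem x j _ hu, mul_zero,
      Finset.sum_const_zero]
  rw [huw]
  have := norm_add_sq_eq_norm_sq_add_norm_sq_real hort
  exact abs_le_of_sq_le_sq' (by nlinarith [norm_nonneg u]) (norm_nonneg _) |>.2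

/-- Adding one more observation does not increase the prediction error of a stationary sequence. -/
theorem residualGram_succ_le {x : ℤ → Fin d → H}
    (hst : ∀ s t a b, ⟪x (s + 1) a, x (t + 1) b⟫ = ⟪x s a, x t b⟫) (j : ℕ) :
    residualGram x (j + 1) ≤ residualGram x j := by
  rw [Matrix.le_iff]
  refine Matrix.PosSemidef.of_dotProduct_mulVec_nonneg
    ((residualGram_isHermitian x j).sub (residualGram_isHermitian x (j + 1))) fun v => ?_
  rw [star_trivial, Matrix.sub_mulVec, dotProduct_sub, dotProduct_residualGram_mulVec,
    dotProduct_residualGram_mulVec, sub_nonneg]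
  -- The coefficients of the best predictor of `x_{j+1}`, shifted by one time unit, give a predictor
  -- of `x_{j+2}` from `x_2, …, x_{j+1}`. By stationarity its error has the same norm, and it
  -- competes with the best predictor from `x_1, …, x_{j+1}`.
  obtain ⟨c, hc⟩ := (Submodule.mem_span_range_iff_exists_fun ℝ).1
    (Submodule.sum_mem (pastSpan x j) (t := Finset.univ) fun a _ => Submodule.smul_mem _ (v a)
        (Submodule.starProjection_apply_mem (pastSpan x j) (x ((j : ℤ) + 1) a)))
  have hr : ∑ a, v a • linResidual x j a = ∑ a, v a • x ((j : ℤ) + 1) a -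
      ∑ i : Fin j × Fin d, c i • x ((i.1 : ℕ) + 1 : ℤ) i.2 := by
    rw [hc]
    simp only [linResidual, smul_sub, Finset.sum_sub_distrib]
  have hshift : ‖∑ a, v a • linResidual x j a‖ = ‖∑ a, v a • x (((j + 1 : ℕ) : ℤ) + 1) a -
      ∑ i : Fin j × Fin d, c i • x (((i.1 : ℕ) + 1 : ℤ) + 1) i.2‖ := by
    have := norm_sum_smul_eq_of_gram_eq (ι := Fin d ⊕ (Fin j × Fin d))
      (f := Sum.elim (fun a => x ((j : ℤ) + 1) a) (fun i => x ((i.1 : ℕ) + 1 : ℤ) i.2))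
      (g := Sum.elim (fun a => x ((j : ℤ) + 1 + 1) a) (fun i => x (((i.1 : ℕ) + 1 : ℤ) + 1) i.2))
      (by rintro (i | i) (k | k) <;> simp [hst]) (Sum.elim v (-c))
    simp only [Fintype.sum_sum_type, Sum.elim_inl, Sum.elim_inr, Pi.neg_apply, neg_smul,
      Finset.sum_neg_distrib, ← sub_eq_add_neg] at this
    rw [hr, this]
    push_cast
    rfl
  have hmem : ∑ i : Fin j × Fin d, c i • x (((i.1 : ℕ) + 1 : ℤ) + 1) i.2 ∈ pastSpan x (j + 1) :=
    Submodule.sum_mem _ fun i _ => Submodule.smul_mem _ _ (by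
      have := mem_pastSpan x (j := j + 1) i.1.succ i.2
      simpa using this)
  have := norm_sum_linResidual_le x (j + 1) v hmem
  rw [← hshift] at this
  gcongr

theorem residualGram_zero (x : ℤ → Fin d → H) :
    residualGram x 0 = Matrix.of fun a b => ⟪x 1 a, x 1 b⟫ := by
  have : ∀ a, linResidual x 0 a = x 1 a := fun a =>
    linResidual_eq_of_mem_of_orthogonal x 0 a (by simp) (fun w hw => by
      have : w = 0 := by
        rwa [pastSpan, Set.range_eq_empty, Submodule.span_empty, Submodule.mem_bot] at hw
      simp [this])
  ext a b
  simp [residualGram, this]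

/-- For a causal autoregression of order `q + 1`, the prediction error given `q + 1` preceding
values is the innovation. -/
theorem residualGram_eq_of_isCausalVAR {q : ℕ} {A : Fin (q + 1) → Matrix (Fin d) (Fin d) ℝ}
    (hA : IsCausalVAR A) {Sig : Matrix (Fin d) (Fin d) ℝ} {x z : ℤ → Fin d → H}
    (hrec : ∀ t a, x t a = ∑ i : Fin (q + 1), ∑ b, A i a b • x (t - ((i : ℕ) + 1 : ℤ)) b + z t a)
    {C : ℝ} (hC : ∀ t a, ‖x t a‖ ≤ C) (hz : ∀ t a b, ⟪z t a, z t b⟫ = Sig a b)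
    (hz0 : ∀ s t a b, s ≠ t → ⟪z s a, z t b⟫ = 0) : residualGram x (q + 1) = Sig := by
  have hres : ∀ a, linResidual x (q + 1) a = z (((q + 1 : ℕ) : ℤ) + 1) a := by
    intro a
    refine linResidual_eq_of_mem_of_orthogonal x (q + 1) a ?_ fun w hw => ?_
    · rw [hrec, add_sub_cancel_right]
      refine Submodule.sum_mem _ fun i _ => Submodule.sum_mem _ fun b _ => Submodule.smul_mem _ _ ?_
      -- Lag `i + 1` from time `q + 2` is time `q + 1 - i`, the entry of index `Fin.rev i` in the
      -- past.
      have := mem_pastSpan x (Fin.rev i) b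
      convert this using 2
      rw [Fin.val_rev]
      omega
    · induction hw using Submodule.span_induction with
      | mem w hw =>
        obtain ⟨i, rfl⟩ := hw
        rw [real_inner_comm]
        refine hA.inner_eq_zero hrec hC (T := ((q + 1 : ℕ) : ℤ)) (fun t ht b => hz0 _ _ _ _ ?_) ?_ _
        · omega
        · have := i.1.2
          omega
      | zero => simp
      | add u w _ _ hu hw => rw [inner_add_right, hu, hw, add_zero]
      | smul c w _ hw => rw [inner_smul_right, hw, mul_zero]
  ext a b
  simp [residualGram, hres, hz]

end Residual

/-! ### Gaussian variables as a closed subset of `L²` -/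

section GaussianSpace

variable {S : Type*} [MeasurableSpace S] {P : Measure S}

theorem inner_toLp_eq_integral {f g : S → ℝ} (hf : MemLp f 2 P) (hg : MemLp g 2 P) :
    ⟪hf.toLp f, hg.toLp g⟫ = ∫ ω, f ω * g ω ∂P := by
  rw [L2.inner_def]
  refine integral_congr_ae ?_
  filter_upwards [hf.coeFn_toLp, hg.coeFn_toLp] with ω h1 h2
  rw [h1, h2]
  simp [mul_comm]

theorem inner_eq_integral_mul (f g : Lp ℝ 2 P) : ⟪f, g⟫ = ∫ ω, f ω * g ω ∂P := by
  rw [L2.inner_def]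
  exact integral_congr_ae (ae_of_all _ fun ω => by simp [mul_comm])

theorem norm_cexp_mul_I_sub_le (x y : ℝ) :
    ‖Complex.exp (x * Complex.I) - Complex.exp (y * Complex.I)‖ ≤ |x - y| := by
  have h : Complex.exp (x * Complex.I) - Complex.exp (y * Complex.I) =
      Complex.exp (y * Complex.I) * (Complex.exp (Complex.I * ((x - y : ℝ) : ℂ)) - 1) := by
    rw [mul_sub, mul_one, ← Complex.exp_add]
    congr 2
    push_cast
    ring
  rw [h, norm_mul, Complex.norm_exp_ofReal_mul_I, one_mul]
  exact Real.norm_exp_I_mul_ofReal_sub_one_le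

/-- A finite family in `L²` all of whose linear combinations are Gaussian is jointly Gaussian. -/
theorem hasGaussianLaw_pi_of_sum_smul {ι : Type*} [Fintype ι] {f : ι → Lp ℝ 2 P} {g : ι → S → ℝ}
    (h : ∀ c : ι → ℝ, HasGaussianLaw (∑ i, c i • f i : Lp ℝ 2 P) P) (hg : ∀ i, g i =ᵐ[P] f i) :
    HasGaussianLaw (fun ω i => g i ω) P := by
  have hgm : AEMeasurable (fun ω i => g i ω) P :=
    aemeasurable_pi_lambda _ fun i => (Lp.aestronglyMeasurable (f i)).aemeasurable.congr (hg i).symm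
  refine ⟨isGaussian_of_isGaussian_map fun L => ?_⟩
  rw [AEMeasurable.map_map_of_aemeasurable (by fun_prop) hgm]
  classical
  refine ((h fun i => L (Pi.single i 1)).congr ?_).isGaussian_map
  have h1 : ∀ᵐ ω ∂P, ∀ i, g i ω = f i ω ∧ (L (Pi.single i 1) • f i : Lp ℝ 2 P) ω =
      L (Pi.single i 1) * f i ω := by
    rw [ae_all_iff]
    intro i
    filter_upwards [hg i, Lp.coeFn_smul (L (Pi.single i 1)) (f i)] with ω h1 h2
    exact ⟨h1, h2⟩
  filter_upwards [h1, Lp.coeFn_finsetSum Finset.univ fun i => L (Pi.single i 1) • f i] with ω h1 h2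
  rw [h2, Finset.sum_apply, Function.comp_apply]
  conv_rhs => rw [← Finset.univ_sum_single (fun i => g i ω), map_sum]
  refine Finset.sum_congr rfl fun i _ => ?_
  rw [(h1 i).2, ← (h1 i).1, mul_comm, ← smul_eq_mul (g i ω), ← map_smul, ← Pi.single_smul,
    smul_eq_mul, mul_one]

variable [IsProbabilityMeasure P]

theorem integral_norm_le_norm_Lp_two (f : Lp ℝ 2 P) : ∫ ω, ‖f ω‖ ∂P ≤ ‖f‖ := by
  rw [integral_norm_eq_lintegral_enorm (Lp.aestronglyMeasurable f), ← eLpNorm_one_eq_lintegral_enorm,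
    Lp.norm_def]
  exact ENNReal.toReal_mono (Lp.eLpNorm_ne_top f)
    (eLpNorm_le_eLpNorm_of_exponent_le (by norm_num) (Lp.aestronglyMeasurable f))

theorem integrable_coe_Lp_two (f : Lp ℝ 2 P) : Integrable f P :=
  (Lp.memLp f).integrable (by norm_num)

/-- Since `x ↦ exp(ix)` is 1-Lipschitz, the characteristic function at `t` is `|t|`-Lipschitz for
the `L¹` distance, which is at most the `L²` distance. -/
theorem continuous_charFun_map_Lp (t : ℝ) :
    Continuous fun f : Lp ℝ 2 P => charFun (P.map f) t := by
  refine (LipschitzWith.of_dist_le_mul (K := ‖t‖₊) fun f g => ?_).continuous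
  have he : ∀ f : Lp ℝ 2 P, charFun (P.map f) t = ∫ ω, Complex.exp ((t * f ω : ℝ) * Complex.I) ∂P := by
    intro f
    rw [charFun_apply_real, integral_map (Lp.aestronglyMeasurable f).aemeasurable
      (by fun_prop)]
    push_cast
    rfl
  have hint : ∀ f : Lp ℝ 2 P, Integrable (fun ω => Complex.exp ((t * f ω : ℝ) * Complex.I)) P := by
    intro f
    refine Integrable.of_bound (C := 1) ?_ (ae_of_all _ fun ω => ?_)
    · have := (Lp.stronglyMeasurable f).measurable
      exact (by fun_prop : Measurable fun ω => Complex.exp ((t * f ω : ℝ) * Complex.I)).aestronglyMeasurable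
    · rw [Complex.norm_exp_ofReal_mul_I]
  rw [he, he, dist_eq_norm, dist_eq_norm, ← integral_sub (hint f) (hint g), coe_nnnorm]
  refine (norm_integral_le_integral_norm _).trans ?_
  refine le_trans ?_ (mul_le_mul_of_nonneg_left (integral_norm_le_norm_Lp_two (f - g))
    (norm_nonneg t))
  rw [← integral_const_mul]
  refine integral_mono_ae ((hint f).sub (hint g)).norm
    ((integrable_coe_Lp_two (f - g)).norm.const_mul _) ?_
  filter_upwards [Lp.coeFn_sub f g] with ω hω
  rw [hω]
  refine (norm_cexp_mul_I_sub_le _ _).trans (le_of_eq ?_)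
  rw [← mul_sub, abs_mul]
  rfl

theorem continuous_integral_Lp_two : Continuous fun f : Lp ℝ 2 P => ∫ ω, f ω ∂P := by
  have h : ∀ f : Lp ℝ 2 P, ∫ ω, f ω ∂P = ⟪(memLp_const (1 : ℝ) : MemLp _ 2 P).toLp _, f⟫ := by
    intro f
    rw [inner_eq_integral_mul]
    refine integral_congr_ae ?_
    filter_upwards [(memLp_const (1 : ℝ) : MemLp _ 2 P).coeFn_toLp] with ω hω
    rw [hω, one_mul]
  simp_rw [h]
  fun_prop

theorem continuous_variance_Lp_two : Continuous fun f : Lp ℝ 2 P => Var[f; P] := by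
  have h : ∀ f : Lp ℝ 2 P, Var[f; P] = ‖f‖ ^ 2 - (∫ ω, f ω ∂P) ^ 2 := by
    intro f
    rw [variance_eq_sub (Lp.memLp f), ← real_inner_self_eq_norm_sq, inner_eq_integral_mul]
    congr 1
    exact integral_congr_ae (ae_of_all _ fun ω => by simp [sq])
  simp_rw [h]
  exact (continuous_norm.pow 2).sub (continuous_integral_Lp_two.pow 2)

/-- Gaussian random variables form a closed subset of `L²`. -/
theorem isClosed_hasGaussianLaw_Lp : IsClosed {f : Lp ℝ 2 P | HasGaussianLaw f P} := by
  -- Being Gaussian is, for each `t`, an equation between the characteristic function and an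
  -- expression in mean and variance; both sides are continuous on `L²`.
  have h : {f : Lp ℝ 2 P | HasGaussianLaw f P} = ⋂ t : ℝ, {f : Lp ℝ 2 P | charFun (P.map f) t =
      Complex.exp (((t * ∫ ω, f ω ∂P : ℝ) : ℂ) * Complex.I - ((t ^ 2 * Var[f; P] : ℝ) : ℂ) / 2)} := by
    ext f
    rw [Set.mem_ofPred_eq, hasGaussianLaw_iff_charFun_map_eq (Lp.aestronglyMeasurable f).aemeasurable,
      Set.mem_iInter]
    refine forall_congr' fun t => ?_
    have h1 : (P[fun ω => ⟪t, f ω⟫] : ℝ) = t * ∫ ω, f ω ∂P := by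
      rw [← integral_const_mul]
      exact integral_congr_ae (ae_of_all _ fun ω => by simp [mul_comm])
    have h2 : Var[fun ω => ⟪t, f ω⟫; P] = t ^ 2 * Var[f; P] := by
      rw [← variance_const_mul]
      congr 1
      ext ω
      simp [mul_comm]
    rw [h1, h2]
    rfl
  rw [h]
  refine isClosed_iInter fun t => isClosed_eq (continuous_charFun_map_Lp t) ?_
  have := continuous_integral_Lp_two (P := P)
  have := continuous_variance_Lp_two (P := P)
  fun_prop

end GaussianSpace

/-! ### Conditional variance and orthogonality -/

/-- If adding the centred variable `Z` to an `n`-measurable variable gives a variable whose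
conditional variance given `n` is almost surely the full variance of `Z`, then `Z` is uncorrelated
with every `n`-measurable variable. -/
theorem integral_mul_eq_zero_of_condVar_eq {S : Type*} {n mS : MeasurableSpace S}
    {P : Measure S} [IsProbabilityMeasure P] (hn : n ≤ mS) {Y G Z : S → ℝ} (hG : StronglyMeasurable[n] G) (hGi : Integrable G P) (hZ : MemLp Z 2 P)
    (hZ0 : ∫ ω, Z ω ∂P = 0) (hY : Y =ᵐ[P] G + Z) {s : ℝ} (hs : Var[Z; P] = s)
    (hvar : P[fun ω => (Y ω - (P[Y | n]) ω) * (Y ω - (P[Y | n]) ω) | n] =ᵐ[P] fun _ => s)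
    {U : S → ℝ} (hU : StronglyMeasurable[n] U) (hU2 : MemLp U 2 P) :
    ∫ ω, Z ω * U ω ∂P = 0 := by
  have hZi : Integrable Z P := hZ.integrable (by norm_num)
  have hYZ : Var[Z; P | n] =ᵐ[P] fun _ => s := by
    refine EventuallyEq.trans (condExp_congr_ae ?_) hvar
    have hG' : P[G | n] = G := condExp_of_stronglyMeasurable hn hG hGi
    filter_upwards [hY, condExp_congr_ae (m := n) hY, condExp_add hGi hZi n] with ω h1 h2 h3
    rw [h2, h1, h3, Pi.add_apply, Pi.add_apply, hG', Pi.pow_apply, Pi.sub_apply]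
    ring
  -- Adding `G` does not change the conditional variance. Total variance then leaves nothing for
  -- `Var[P[Z | n]]`, so `P[Z | n]` is its mean `0`.
  have htot := integral_condVar_add_variance_condExp hn hZ
  rw [integral_congr_ae hYZ, hs] at htot
  have hv0 : Var[P[Z | n]; P] = 0 := by
    simp at htot
    exact htot
  have hc := ae_eq_integral_of_variance_eq_zero (hZ.condExp (by norm_num)) hv0
  rw [integral_condExp hn, hZ0] at hc
  have hpull := condExp_mul_of_stronglyMeasurable_right hU (hZ.integrable_mul hU2) hZi
  have : ∫ ω, (Z * U) ω ∂P = 0 := by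
    rw [← integral_condExp hn, integral_congr_ae hpull]
    refine integral_eq_zero_of_ae ?_
    filter_upwards [hc] with ω hω
    rw [Pi.mul_apply, hω, zero_mul]
    rfl
  exact this

theorem measurable_obsSigma_apply {S : Type*} {d : ℕ} (X : ℤ → S → EuclideanSpace ℝ (Fin d)) {j : ℕ} (i : Fin j)
    (b : Fin d) : Measurable[obsSigma X j] fun ω => X ((i : ℕ) + 1 : ℤ) ω b := by
  have h1 : Measurable[obsSigma X j] fun (ω : S) (i : Fin j) => X ((i : ℕ) + 1 : ℤ) ω :=
    comap_measurable _
  have h2 : Measurable fun v : Fin j → EuclideanSpace ℝ (Fin d) => v i b := by fun_prop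
  exact h2.comp h1

/-! ### Conditional dispersion of a Gaussian process -/

section Prediction

variable {S : Type*} [MeasurableSpace S] {P : Measure S} [IsProbabilityMeasure P] {d : ℕ}
  {X : ℤ → S → EuclideanSpace ℝ (Fin d)} {m : Fin d → ℝ} {x : ℤ → Fin d → Lp ℝ 2 P}

theorem obsSigma_le (hXm : ∀ t, Measurable (X t)) (j : ℕ) : obsSigma X j ≤ ‹MeasurableSpace S› :=
  (measurable_pi_lambda _ fun _ => hXm _).comap_le

/-- A jointly Gaussian vector of prediction errors is independent of the observations. -/
theorem indepFun_linResidual_obs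
    (hx : ∀ t a, x t a =ᵐ[P] fun ω => X t ω a - m a) (hmean : ∀ t a, ∫ ω, x t a ω ∂P = 0)
    (hG : ∀ f ∈ Submodule.span ℝ (Set.range fun i : ℤ × Fin d => x i.1 i.2), HasGaussianLaw f P)
    (j : ℕ) :
    IndepFun (fun ω a => linResidual x j a ω) (fun ω (i : Fin j) => X ((i : ℕ) + 1 : ℤ) ω) P := by
  set V : Fin j × Fin d → S → ℝ := fun i ω => X ((i.1 : ℕ) + 1 : ℤ) ω i.2 - m i.2 with hV
  have hK : pastSpan x j ≤ Submodule.span ℝ (Set.range fun i : ℤ × Fin d => x i.1 i.2) :=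
    Submodule.span_mono (by rintro _ ⟨i, rfl⟩; exact ⟨((i.1 : ℕ) + 1, i.2), rfl⟩)
  have hpi : HasGaussianLaw (fun ω (i : Fin d ⊕ (Fin j × Fin d)) =>
      Sum.elim (fun a => ((linResidual x j a : Lp ℝ 2 P) : S → ℝ)) V i ω) P := by
    refine hasGaussianLaw_pi_of_sum_smul (f := Sum.elim (linResidual x j)
      (fun i : Fin j × Fin d => x ((i.1 : ℕ) + 1 : ℤ) i.2)) (fun c => hG _ ?_) ?_
    · refine Submodule.sum_mem _ fun i _ => Submodule.smul_mem _ _ ?_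
      rcases i with a | i
      · exact Submodule.sub_mem _ (Submodule.subset_span ⟨(_, a), rfl⟩)
          (hK (Submodule.starProjection_apply_mem _ _))
      · exact Submodule.subset_span ⟨(_, i.2), rfl⟩
    · rintro (a | i)
      · exact EventuallyEq.rfl
      · exact (hx _ _).symm
  let L : (Fin d ⊕ (Fin j × Fin d) → ℝ) →L[ℝ] (Fin d → ℝ) × (Fin j × Fin d → ℝ) :=
    (ContinuousLinearMap.pi fun a => ContinuousLinearMap.proj (Sum.inl a)).prod
      (ContinuousLinearMap.pi fun i => ContinuousLinearMap.proj (Sum.inr i))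
  have hpair : HasGaussianLaw (fun ω => (fun a => linResidual x j a ω, fun i => V i ω)) P :=
    hpi.map_fun L
  have hVx : ∀ i, V i =ᵐ[P] x ((i.1 : ℕ) + 1 : ℤ) i.2 := fun i => (hx _ _).symm
  -- For jointly Gaussian vectors, zero covariance suffices for independence; the covariances vanish
  -- because residuals are orthogonal to the past.
  have hind := hpair.indepFun_of_covariance_eval fun a i => by
    have hVL : MemLp (V i) 2 P := (Lp.memLp _).ae_eq (hVx i).symm
    rw [covariance_eq_sub (Lp.memLp _) hVL, integral_congr_ae (hVx i), hmean, mul_zero, sub_zero,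
      ← inner_linResidual_of_mem x j a (mem_pastSpan x i.1 i.2), inner_eq_integral_mul]
    refine integral_congr_ae ?_
    filter_upwards [hVx i] with ω hω
    rw [Pi.mul_apply, hω]
  -- Undoing the centring recovers the observations as a measurable function of `V`.
  let g : (Fin j × Fin d → ℝ) → Fin j → EuclideanSpace ℝ (Fin d) := fun v i =>
    WithLp.toLp 2 fun b => v (i, b) + m b
  have hg : Measurable g := by
    refine measurable_pi_lambda _ fun i => ?_
    fun_prop
  have hgV : (g ∘ fun ω i => V i ω) = fun ω (i : Fin j) => X ((i : ℕ) + 1 : ℤ) ω := by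
    funext ω i
    refine PiLp.ext fun b => ?_
    simp [g, hV]
  have := hind.comp measurable_id hg
  rwa [hgV] at this

/-- The observation is the residual plus an affine function `G` of the past; the residual is
independent of the past and has mean zero, so only `G` survives conditioning. -/
theorem condExp_ae_eq_sub_linResidual (hXm : ∀ t, Measurable (X t))
    (hx : ∀ t a, x t a =ᵐ[P] fun ω => X t ω a - m a) (hmean : ∀ t a, ∫ ω, x t a ω ∂P = 0)
    (hG : ∀ f ∈ Submodule.span ℝ (Set.range fun i : ℤ × Fin d => x i.1 i.2), HasGaussianLaw f P)
    (j : ℕ) (a : Fin d) :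
    P[fun ω => X ((j : ℤ) + 1) ω a | obsSigma X j] =ᵐ[P]
      fun ω => X ((j : ℤ) + 1) ω a - linResidual x j a ω := by
  obtain ⟨c, hc⟩ := (Submodule.mem_span_range_iff_exists_fun ℝ).1
    (Submodule.starProjection_apply_mem (pastSpan x j) (x ((j : ℤ) + 1) a))
  let G : S → ℝ := fun ω => m a + ∑ i, c i * (X ((i.1 : ℕ) + 1 : ℤ) ω i.2 - m i.2)
  have hGm : StronglyMeasurable[obsSigma X j] G := by
    refine Measurable.stronglyMeasurable ?_
    refine measurable_const.add (Finset.measurable_sum _ fun i _ => ?_)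
    exact ((measurable_obsSigma_apply X i.1 i.2).sub measurable_const).const_mul _
  have hGi : Integrable G P := by
    refine (integrable_const _).add (integrable_finsetSum _ fun i _ => Integrable.const_mul ?_ _)
    exact (integrable_coe_Lp_two (x _ _)).congr (hx _ _)
  have hres : (fun ω => X ((j : ℤ) + 1) ω a) =ᵐ[P] ((linResidual x j a : Lp ℝ 2 P) : S → ℝ) + G := by
    have h1 : ∀ᵐ ω ∂P, ∀ i : Fin j × Fin d, (c i • x ((i.1 : ℕ) + 1 : ℤ) i.2 : Lp ℝ 2 P) ω =
        c i * (X ((i.1 : ℕ) + 1 : ℤ) ω i.2 - m i.2) := by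
      rw [ae_all_iff]
      intro i
      filter_upwards [hx ((i.1 : ℕ) + 1 : ℤ) i.2, Lp.coeFn_smul (c i) (x ((i.1 : ℕ) + 1 : ℤ) i.2)]
        with ω h1 h2
      rw [h2, Pi.smul_apply, h1, smul_eq_mul]
    have h2 : linResidual x j a = x ((j : ℤ) + 1) a -
        ∑ i : Fin j × Fin d, c i • x ((i.1 : ℕ) + 1 : ℤ) i.2 := by rw [hc]; rfl
    rw [h2]
    filter_upwards [h1, hx ((j : ℤ) + 1) a,
      Lp.coeFn_sub (x ((j : ℤ) + 1) a) (∑ i : Fin j × Fin d, c i • x ((i.1 : ℕ) + 1 : ℤ) i.2),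
      Lp.coeFn_finsetSum Finset.univ fun i : Fin j × Fin d => c i • x ((i.1 : ℕ) + 1 : ℤ) i.2]
      with ω h1 h3 h4 h5
    rw [Pi.add_apply, h4, Pi.sub_apply, h3, h5, Finset.sum_apply, Finset.sum_congr rfl fun i _ => h1 i]
    simp only [G]
    ring
  have hle := obsSigma_le hXm j
  have hrm : Measurable fun ω a => linResidual x j a ω :=
    measurable_pi_lambda _ fun a => (Lp.stronglyMeasurable _).measurable
  have h0 : P[((linResidual x j a : Lp ℝ 2 P) : S → ℝ) | obsSigma X j] =ᵐ[P]
      fun _ => P[((linResidual x j a : Lp ℝ 2 P) : S → ℝ)] := by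
    refine condExp_indep_eq hrm.comap_le hle ?_
      ((IndepFun_iff_Indep _ _ _).1 (indepFun_linResidual_obs hx hmean hG j))
    exact Measurable.stronglyMeasurable ((measurable_pi_apply (X := fun _ : Fin d => ℝ) a).comp
      (comap_measurable _))
  have hr0 : P[((linResidual x j a : Lp ℝ 2 P) : S → ℝ)] = 0 := by
    have h1 := integral_congr_ae hres
    rw [integral_add' (integrable_coe_Lp_two _) hGi] at h1
    have h2 : ∀ t b, ∫ ω, (X t ω b - m b) ∂P = 0 := fun t b => by
      rw [← hmean t b]
      exact (integral_congr_ae (hx t b)).symm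
    have hXi : ∀ t b, Integrable (fun ω => X t ω b - m b) P := fun t b =>
      (integrable_coe_Lp_two (x t b)).congr (hx t b)
    have h3 : ∫ ω, G ω ∂P = m a := by
      have hi : ∀ i : Fin j × Fin d,
          Integrable (fun ω => c i * (X ((i.1 : ℕ) + 1 : ℤ) ω i.2 - m i.2)) P :=
        fun i => (hXi _ _).const_mul _
      simp only [G]
      rw [integral_add (integrable_const _) (integrable_finsetSum _ fun i _ => hi i),
        integral_finsetSum _ fun i _ => hi i]
      simp [integral_const_mul, h2]
    have h4 : ∫ ω, X ((j : ℤ) + 1) ω a ∂P = m a := by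
      have h5 : (fun ω => X ((j : ℤ) + 1) ω a) = fun ω => (X ((j : ℤ) + 1) ω a - m a) + m a := by
        ext ω; ring
      rw [h5, integral_add (hXi _ _) (integrable_const _), h2]
      simp
    rw [h3, h4] at h1
    linarith
  have hG' : P[G | obsSigma X j] = G := condExp_of_stronglyMeasurable hle hGm hGi
  filter_upwards [condExp_congr_ae (m := obsSigma X j) hres,
    condExp_add (integrable_coe_Lp_two (linResidual x j a)) hGi (obsSigma X j), h0, hres]
    with ω h1 h2 h3 h4
  rw [h1, h2, Pi.add_apply, h3, hr0, hG', h4, Pi.add_apply]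
  ring

/-- For a Gaussian process, the conditional dispersion matrix is almost surely constant, equal to
the covariance matrix of the linear prediction errors. -/
theorem condDispersion_ae_eq_residualGram (hXm : ∀ t, Measurable (X t))
    (hx : ∀ t a, x t a =ᵐ[P] fun ω => X t ω a - m a) (hmean : ∀ t a, ∫ ω, x t a ω ∂P = 0)
    (hG : ∀ f ∈ Submodule.span ℝ (Set.range fun i : ℤ × Fin d => x i.1 i.2), HasGaussianLaw f P)
    (j : ℕ) : ∀ᵐ ω ∂P, condDispersion P X j ω = residualGram x j := by
  have hle := obsSigma_le hXm j
  have hrm : Measurable fun ω a => linResidual x j a ω :=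
    measurable_pi_lambda _ fun a => (Lp.stronglyMeasurable _).measurable
  have h : ∀ a b, ∀ᵐ ω ∂P, condDispersion P X j ω a b = residualGram x j a b := by
    intro a b
    have h1 : (fun ω' => (X ((j : ℤ) + 1) ω' a -
        (P[fun η => X ((j : ℤ) + 1) η a | obsSigma X j]) ω') *
        (X ((j : ℤ) + 1) ω' b - (P[fun η => X ((j : ℤ) + 1) η b | obsSigma X j]) ω')) =ᵐ[P]
        fun ω => linResidual x j a ω * linResidual x j b ω := by
      filter_upwards [condExp_ae_eq_sub_linResidual hXm hx hmean hG j a,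
        condExp_ae_eq_sub_linResidual hXm hx hmean hG j b] with ω h1 h2
      rw [h1, h2]
      ring
    have h2 : P[fun ω => linResidual x j a ω * linResidual x j b ω | obsSigma X j] =ᵐ[P]
        fun _ => P[fun ω => linResidual x j a ω * linResidual x j b ω] := by
      refine condExp_indep_eq hrm.comap_le hle ?_
        ((IndepFun_iff_Indep _ _ _).1 (indepFun_linResidual_obs hx hmean hG j))
      refine Measurable.stronglyMeasurable (Measurable.mul ?_ ?_)
      · exact (measurable_pi_apply (X := fun _ : Fin d => ℝ) a).comp (comap_measurable _)
      · exact (measurable_pi_apply (X := fun _ : Fin d => ℝ) b).comp (comap_measurable _)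
    filter_upwards [condExp_congr_ae (m := obsSigma X j) h1, h2] with ω h3 h4
    rw [condDispersion, condVarMatrix, Matrix.of_apply, h3, h4, residualGram, Matrix.of_apply,
      inner_eq_integral_mul]
  have h' := ae_all_iff.2 fun a => ae_all_iff.2 fun b => h a b
  filter_upwards [h'] with ω hω
  ext a b
  exact hω a b

end Prediction

/-! ### Moments and Gaussian span of the white noise -/

section WhiteNoise

variable {S : Type*} [MeasurableSpace S] {P : Measure S} {d : ℕ}
  {Sig : Matrix (Fin d) (Fin d) ℝ} {Z : ℤ → S → EuclideanSpace ℝ (Fin d)}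

theorem MeasureTheory.MemLp.euclidean_apply {Y : S → EuclideanSpace ℝ (Fin d)} (hY : MemLp Y 2 P)
    (a : Fin d) : MemLp (fun ω => Y ω a) 2 P :=
  (EuclideanSpace.proj (𝕜 := ℝ) a).comp_memLp' hY

theorem IsGaussianWhiteNoise.hasGaussianLaw (hZ : IsGaussianWhiteNoise P Sig Z) (t : ℤ) :
    HasGaussianLaw (Z t) P :=
  ⟨by rw [hZ.law t]; infer_instance⟩

theorem IsGaussianWhiteNoise.memLp (hZ : IsGaussianWhiteNoise P Sig Z) (t : ℤ) (a : Fin d) :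
    MemLp (fun ω => Z t ω a) 2 P :=
  (hZ.hasGaussianLaw t).memLp_two.euclidean_apply a

theorem IsGaussianWhiteNoise.integral_eq_zero (hZ : IsGaussianWhiteNoise P Sig Z) (t : ℤ)
    (a : Fin d) : ∫ ω, Z t ω a ∂P = 0 := by
  have h1 : ∫ ω, (EuclideanSpace.proj (𝕜 := ℝ) a) (Z t ω) ∂P =
      (EuclideanSpace.proj (𝕜 := ℝ) a) (∫ ω, Z t ω ∂P) :=
    ContinuousLinearMap.integral_comp_comm _ (hZ.hasGaussianLaw t).integrable
  have h2 : ∫ ω, Z t ω ∂P = 0 := by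
    have := integral_map (μ := P) (hZ.measurable t).aemeasurable (f := id) (by fun_prop)
    rw [hZ.law t] at this
    simpa using this.symm
  rw [h2, map_zero] at h1
  exact h1

theorem IsGaussianWhiteNoise.covariance_eq (hZ : IsGaussianWhiteNoise P Sig Z)
    (hSig : Sig.PosSemidef) (t : ℤ) (a b : Fin d) :
    cov[fun ω => Z t ω a, fun ω => Z t ω b; P] = Sig a b := by
  rw [← covariance_eval_multivariateGaussian (μ := 0) hSig a b, ← hZ.law t,
    covariance_map_fun (by fun_prop) (by fun_prop) (hZ.measurable t).aemeasurable]

theorem IsGaussianWhiteNoise.integral_mul (hZ : IsGaussianWhiteNoise P Sig Z)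
    (hSig : Sig.PosSemidef) (t : ℤ) (a b : Fin d) :
    ∫ ω, Z t ω a * Z t ω b ∂P = Sig a b := by
  rw [← hZ.covariance_eq hSig t a b, covariance]
  simp [hZ.integral_eq_zero]

theorem IsGaussianWhiteNoise.integral_mul_of_ne (hZ : IsGaussianWhiteNoise P Sig Z) {s t : ℤ}
    (hst : s ≠ t) (a b : Fin d) : ∫ ω, Z s ω a * Z t ω b ∂P = 0 := by
  have h1 : IndepFun (fun ω => Z s ω a) (fun ω => Z t ω b) P :=
    (hZ.indep.indepFun hst).comp (φ := fun v : EuclideanSpace ℝ (Fin d) => v a)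
      (ψ := fun v : EuclideanSpace ℝ (Fin d) => v b) (by fun_prop) (by fun_prop)
  have := h1.covariance_eq_zero (hZ.memLp s a) (hZ.memLp t b)
  simpa [covariance, hZ.integral_eq_zero] using this

theorem IsGaussianWhiteNoise.hasGaussianLaw_of_mem_span (hZ : IsGaussianWhiteNoise P Sig Z)
    {f : Lp ℝ 2 P} (hf : f ∈ Submodule.span ℝ
      (Set.range fun i : ℤ × Fin d => (hZ.memLp i.1 i.2).toLp _)) : HasGaussianLaw f P := by
  classical
  obtain ⟨c, rfl⟩ := Finsupp.mem_span_range_iff_exists_finsupp.1 hf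
  let I : Finset ℤ := c.support.image Prod.fst
  have hI : HasGaussianLaw (fun ω (t : I) => Z t ω) P :=
    (hZ.indep.precomp Subtype.val_injective).hasGaussianLaw fun t => hZ.hasGaussianLaw t
  let L : (I → EuclideanSpace ℝ (Fin d)) →L[ℝ] ℝ := ∑ i : c.support, c i •
    ((EuclideanSpace.proj (𝕜 := ℝ) i.1.2).comp
      (ContinuousLinearMap.proj ⟨i.1.1, Finset.mem_image_of_mem _ i.2⟩))
  refine (hI.map_fun L).congr ?_
  have h1 : ∀ᵐ ω ∂P, ∀ i : ℤ × Fin d, (c i • (hZ.memLp i.1 i.2).toLp _ : Lp ℝ 2 P) ω =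
      c i * Z i.1 ω i.2 := by
    rw [ae_all_iff]
    intro i
    filter_upwards [Lp.coeFn_smul (c i) ((hZ.memLp i.1 i.2).toLp _), (hZ.memLp i.1 i.2).coeFn_toLp]
      with ω h1 h2
    rw [h1, Pi.smul_apply, h2, smul_eq_mul]
  filter_upwards [h1, Lp.coeFn_finsetSum c.support fun i => c i • (hZ.memLp i.1 i.2).toLp _]
    with ω h1 h2
  rw [Finsupp.sum, h2, Finset.sum_apply, Finset.sum_congr rfl fun i _ => h1 i,
    ← Finset.sum_coe_sort c.support]
  simp [L]

/-- Every element of the closed linear span of Gaussian white noise is Gaussian. -/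
theorem IsGaussianWhiteNoise.hasGaussianLaw_of_mem_closure [IsProbabilityMeasure P]
    (hZ : IsGaussianWhiteNoise P Sig Z) {f : Lp ℝ 2 P}
    (hf : f ∈ (Submodule.span ℝ
      (Set.range fun i : ℤ × Fin d => (hZ.memLp i.1 i.2).toLp _)).topologicalClosure) :
    HasGaussianLaw f P :=
  closure_minimal (fun _ hg => hZ.hasGaussianLaw_of_mem_span hg) isClosed_hasGaussianLaw_Lp hf

end WhiteNoise

/-! ### Stationarity, centring and the autoregression in `L²` -/

section Stationary

variable {S : Type*} [MeasurableSpace S] {P : Measure S} {d : ℕ}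
  {X : ℤ → S → EuclideanSpace ℝ (Fin d)}

theorem IsStationaryProcess.integral_comp_shift {E : Type*} [MeasurableSpace E] {X : ℤ → S → E}
    (hX : IsStationaryProcess P X) (hXm : ∀ t, Measurable (X t)) {φ : (ℤ → E) → ℝ}
    (hφ : Measurable φ) (h : ℤ) :
    ∫ ω, φ (fun t => X (t + h) ω) ∂P = ∫ ω, φ (fun t => X t ω) ∂P := by
  rw [← integral_map (φ := fun ω t => X (t + h) ω) (f := φ)
      (measurable_pi_lambda _ fun t => hXm _).aemeasurable hφ.aestronglyMeasurable, hX h,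
    integral_map (measurable_pi_lambda _ fun t => hXm _).aemeasurable hφ.aestronglyMeasurable]

end Stationary

section Centred

variable {S : Type*} [MeasurableSpace S] {P : Measure S} [IsProbabilityMeasure P] {d : ℕ}
  {X : ℤ → S → EuclideanSpace ℝ (Fin d)}

/-- The coordinates of a process, centred by the mean at time `0`, as elements of `L²`. -/
noncomputable def centredLp (hX2 : ∀ t, MemLp (X t) 2 P) (t : ℤ) (a : Fin d) : Lp ℝ 2 P :=
  (((hX2 t).euclidean_apply a).sub (memLp_const (∫ ω, X 0 ω a ∂P))).toLp _

theorem centredLp_ae_eq (hX2 : ∀ t, MemLp (X t) 2 P) (t : ℤ) (a : Fin d) :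
    centredLp hX2 t a =ᵐ[P] fun ω => X t ω a - ∫ ω, X 0 ω a ∂P :=
  MemLp.coeFn_toLp _

theorem inner_centredLp (hX2 : ∀ t, MemLp (X t) 2 P) (s t : ℤ) (a b : Fin d) :
    ⟪centredLp hX2 s a, centredLp hX2 t b⟫ =
      ∫ ω, (X s ω a - ∫ ω, X 0 ω a ∂P) * (X t ω b - ∫ ω, X 0 ω b ∂P) ∂P :=
  inner_toLp_eq_integral _ _

omit [IsProbabilityMeasure P] in
theorem IsStationaryProcess.integral_apply (hstat : IsStationaryProcess P X)
    (hXm : ∀ t, Measurable (X t)) (t : ℤ) (a : Fin d) :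
    ∫ ω, X t ω a ∂P = ∫ ω, X 0 ω a ∂P := by
  simpa using hstat.integral_comp_shift hXm (φ := fun v => v 0 a) (by fun_prop) t

theorem IsStationaryProcess.integral_centredLp (hstat : IsStationaryProcess P X)
    (hXm : ∀ t, Measurable (X t)) (hX2 : ∀ t, MemLp (X t) 2 P) (t : ℤ) (a : Fin d) :
    ∫ ω, centredLp hX2 t a ω ∂P = 0 := by
  rw [integral_congr_ae (centredLp_ae_eq hX2 t a),
    integral_sub (((hX2 t).euclidean_apply a).integrable (by norm_num)) (integrable_const _),
    hstat.integral_apply hXm]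
  simp

theorem IsStationaryProcess.inner_centredLp_succ (hstat : IsStationaryProcess P X)
    (hXm : ∀ t, Measurable (X t)) (hX2 : ∀ t, MemLp (X t) 2 P) (s t : ℤ) (a b : Fin d) :
    ⟪centredLp hX2 (s + 1) a, centredLp hX2 (t + 1) b⟫ =
      ⟪centredLp hX2 s a, centredLp hX2 t b⟫ := by
  rw [inner_centredLp, inner_centredLp]
  exact hstat.integral_comp_shift hXm
    (φ := fun v => (v s a - ∫ ω, X 0 ω a ∂P) * (v t b - ∫ ω, X 0 ω b ∂P)) (by fun_prop) 1

theorem IsStationaryProcess.norm_centredLp_le (hstat : IsStationaryProcess P X)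
    (hXm : ∀ t, Measurable (X t)) (hX2 : ∀ t, MemLp (X t) 2 P) (t : ℤ) (a : Fin d) :
    ‖centredLp hX2 t a‖ ≤ ∑ b, ‖centredLp hX2 0 b‖ := by
  have h : ‖centredLp hX2 t a‖ = ‖centredLp hX2 0 a‖ := by
    refine (pow_left_inj₀ (norm_nonneg _) (norm_nonneg _) two_ne_zero).1 ?_
    rw [← real_inner_self_eq_norm_sq, ← real_inner_self_eq_norm_sq, inner_centredLp,
      inner_centredLp]
    simpa using hstat.integral_comp_shift hXm
      (φ := fun v => (v 0 a - ∫ ω, X 0 ω a ∂P) * (v 0 a - ∫ ω, X 0 ω a ∂P)) (by fun_prop) t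
  rw [h]
  exact Finset.single_le_sum (f := fun b => ‖centredLp hX2 0 b‖) (fun b _ => norm_nonneg _)
    (Finset.mem_univ a)

variable {p : ℕ} {c : EuclideanSpace ℝ (Fin d)} {A : Fin p → Matrix (Fin d) (Fin d) ℝ}
  {Sig : Matrix (Fin d) (Fin d) ℝ} {Z : ℤ → S → EuclideanSpace ℝ (Fin d)}

omit [IsProbabilityMeasure P] in
theorem SatisfiesVAR.ae_apply (hVAR : SatisfiesVAR P c A X Z) (t : ℤ) : ∀ᵐ ω ∂P, ∀ a,
    X t ω a = c a + ∑ i : Fin p, ∑ b, A i a b * X (t - ((i : ℕ) + 1 : ℤ)) ω b + Z t ω a := by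
  filter_upwards [hVAR t] with ω hω a
  conv_lhs => rw [hω]
  simp [Matrix.mulVec, dotProduct]

/-- This relation cancels the intercept `c` when the recursion is centred. -/
theorem SatisfiesVAR.mean_eq (hVAR : SatisfiesVAR P c A X Z) (hstat : IsStationaryProcess P X)
    (hXm : ∀ t, Measurable (X t)) (hX2 : ∀ t, MemLp (X t) 2 P)
    (hZ : IsGaussianWhiteNoise P Sig Z) (a : Fin d) :
    ∫ ω, X 0 ω a ∂P = c a + ∑ i : Fin p, ∑ b, A i a b * ∫ ω, X 0 ω b ∂P := by
  have hi : ∀ t b, Integrable (fun ω => X t ω b) P := fun t b =>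
    ((hX2 t).euclidean_apply b).integrable (by norm_num)
  have h1 : ∫ ω, X 0 ω a ∂P = ∫ ω, (c a +
      ∑ i : Fin p, ∑ b, A i a b * X (0 - ((i : ℕ) + 1 : ℤ)) ω b + Z 0 ω a) ∂P := by
    refine integral_congr_ae ?_
    filter_upwards [hVAR.ae_apply 0] with ω hω
    exact hω a
  have h2 : ∀ i : Fin p, Integrable (fun ω => ∑ b, A i a b * X (0 - ((i : ℕ) + 1 : ℤ)) ω b) P :=
    fun i => integrable_finsetSum _ fun b _ => (hi _ b).const_mul _
  have h3 : Integrable (fun ω => ∑ i : Fin p, ∑ b, A i a b * X (0 - ((i : ℕ) + 1 : ℤ)) ω b) P :=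
    integrable_finsetSum _ fun i _ => h2 i
  have h4 : Integrable (fun ω => c a +
      ∑ i : Fin p, ∑ b, A i a b * X (0 - ((i : ℕ) + 1 : ℤ)) ω b) P := (integrable_const _).add h3
  rw [h1, integral_add h4 ((hZ.memLp 0 a).integrable (by norm_num)),
    integral_add (integrable_const _) h3, hZ.integral_eq_zero, add_zero,
    integral_finsetSum _ fun i _ => h2 i]
  congr 1
  · simp
  · refine Finset.sum_congr rfl fun i _ => ?_
    rw [integral_finsetSum _ fun b _ => (hi _ b).const_mul _]
    refine Finset.sum_congr rfl fun b _ => ?_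
    rw [integral_const_mul, hstat.integral_apply hXm]

theorem SatisfiesVAR.centredLp_eq (hVAR : SatisfiesVAR P c A X Z) (hstat : IsStationaryProcess P X)
    (hXm : ∀ t, Measurable (X t)) (hX2 : ∀ t, MemLp (X t) 2 P)
    (hZ : IsGaussianWhiteNoise P Sig Z) (t : ℤ) (a : Fin d) :
    centredLp hX2 t a =
      ∑ i : Fin p, ∑ b, A i a b • centredLp hX2 (t - ((i : ℕ) + 1 : ℤ)) b +
        (hZ.memLp t a).toLp _ := by
  refine Lp.ext ?_
  have h1 : ∀ᵐ ω ∂P, ∀ (i : Fin p) b,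
      (A i a b • centredLp hX2 (t - ((i : ℕ) + 1 : ℤ)) b : Lp ℝ 2 P) ω =
        A i a b * (X (t - ((i : ℕ) + 1 : ℤ)) ω b - ∫ ω, X 0 ω b ∂P) := by
    refine ae_all_iff.2 fun i => ae_all_iff.2 fun b => ?_
    filter_upwards [Lp.coeFn_smul (A i a b) (centredLp hX2 (t - ((i : ℕ) + 1 : ℤ)) b),
      centredLp_ae_eq hX2 (t - ((i : ℕ) + 1 : ℤ)) b] with ω h1 h2
    rw [h1, Pi.smul_apply, h2, smul_eq_mul]
  have h2 : ∀ᵐ ω ∂P, ∀ i : Fin p,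
      (∑ b, A i a b • centredLp hX2 (t - ((i : ℕ) + 1 : ℤ)) b : Lp ℝ 2 P) ω =
      ∑ b, (A i a b • centredLp hX2 (t - ((i : ℕ) + 1 : ℤ)) b : Lp ℝ 2 P) ω := by
    refine ae_all_iff.2 fun i => ?_
    filter_upwards [Lp.coeFn_finsetSum Finset.univ
      fun b => A i a b • centredLp hX2 (t - ((i : ℕ) + 1 : ℤ)) b] with ω h
    rw [h, Finset.sum_apply]
  filter_upwards [h1, h2, centredLp_ae_eq hX2 t a, hVAR.ae_apply t, (hZ.memLp t a).coeFn_toLp,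
    Lp.coeFn_finsetSum Finset.univ
      fun i : Fin p => ∑ b, A i a b • centredLp hX2 (t - ((i : ℕ) + 1 : ℤ)) b,
    Lp.coeFn_add (∑ i : Fin p, ∑ b, A i a b • centredLp hX2 (t - ((i : ℕ) + 1 : ℤ)) b)
      ((hZ.memLp t a).toLp _)] with ω h1 h2 h3 h4 h5 h6 h7
  rw [h3, h7, Pi.add_apply, h6, Finset.sum_apply, h5, h4 a, hVAR.mean_eq hstat hXm hX2 hZ a,
    Finset.sum_congr rfl fun i _ => (h2 i).trans (Finset.sum_congr rfl fun b _ => h1 i b)]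
  simp only [mul_sub, Finset.sum_sub_distrib]
  ring

/-- If the conditional dispersion given `p` values equals the innovation variance, the innovations
are orthogonal to the `p` preceding values. -/
theorem SatisfiesVAR.inner_eq_zero_of_condDispersion_eq (hVAR : SatisfiesVAR P c A X Z)
    (hXm : ∀ t, Measurable (X t)) (hX2 : ∀ t, MemLp (X t) 2 P)
    (hZ : IsGaussianWhiteNoise P Sig Z) (hSig : Sig.PosSemidef)
    (hC : ∀ᵐ ω ∂P, condDispersion P X p ω = Sig) (a : Fin d) (k : Fin p) (b : Fin d) :
    ⟪((hZ.memLp ((p : ℤ) + 1) a).toLp _ : Lp ℝ 2 P), centredLp hX2 ((k : ℕ) + 1 : ℤ) b⟫ = 0 := by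
  have hidx : ∀ i : Fin p, (p : ℤ) + 1 - ((i : ℕ) + 1 : ℤ) = ((Fin.rev i : ℕ) : ℤ) + 1 := by
    intro i
    rw [Fin.val_rev]
    omega
  refine (inner_toLp_eq_integral _ _).trans ?_
  have hGm : Measurable[obsSigma X p] fun ω =>
      c a + ∑ i : Fin p, ∑ b, A i a b * X ((p : ℤ) + 1 - ((i : ℕ) + 1 : ℤ)) ω b := by
    refine measurable_const.add (Finset.measurable_sum _ fun i _ =>
      Finset.measurable_sum _ fun b _ => Measurable.const_mul ?_ _)
    rw [hidx]
    exact measurable_obsSigma_apply X _ b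
  refine integral_mul_eq_zero_of_condVar_eq (obsSigma_le hXm p) (Y := fun ω => X ((p : ℤ) + 1) ω a)
    hGm.stronglyMeasurable ?_ (hZ.memLp _ a) (hZ.integral_eq_zero _ a) ?_ (s := Sig a a) ?_ ?_
    ((measurable_obsSigma_apply X k b).sub measurable_const).stronglyMeasurable
    (((hX2 _).euclidean_apply b).sub (memLp_const _))
  · refine (integrable_const _).add (integrable_finsetSum _ fun i _ =>
      integrable_finsetSum _ fun b _ => Integrable.const_mul ?_ _)
    exact ((hX2 _).euclidean_apply b).integrable (by norm_num)
  · filter_upwards [hVAR.ae_apply ((p : ℤ) + 1)] with ω hω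
    exact hω a
  · rw [← covariance_self (hZ.memLp _ a).aestronglyMeasurable.aemeasurable,
      hZ.covariance_eq hSig]
  · filter_upwards [hC] with ω hω
    rw [← hω]
    rfl

end Centred

/-! ### The equivalence -/

theorem eq_of_add_one_eq {α : Type*} {f : ℤ → α} (h : ∀ t, f (t + 1) = f t) (s t : ℤ) :
    f s = f t := by
  have h0 : ∀ t, f t = f 0 := fun t => by
    induction t using Int.induction_on with
    | zero => rfl
    | succ n ih => rw [h, ih]
    | pred n ih => rw [← h, sub_add_cancel, ih]
  rw [h0 s, h0 t]

/-- `≤` between matrices is the Loewner order: `M ≤ N` means that `N - M` is positive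
semidefinite. The conditional variances `C_j` are random matrices, so the chain is asserted
almost surely. -/
theorem proposition1 {S : Type*} [MeasurableSpace S] (P : Measure S) [IsProbabilityMeasure P]
    {d p : ℕ} (hp : 1 ≤ p)
    (c : EuclideanSpace ℝ (Fin d)) (A : Fin p → Matrix (Fin d) (Fin d) ℝ)
    (Om Sig : Matrix (Fin d) (Fin d) ℝ) (hOm : Om.PosDef) (hSig : Sig.PosDef)
    (X Z : ℤ → S → EuclideanSpace ℝ (Fin d))
    (hXm : ∀ t, Measurable (X t)) (hX2 : ∀ t, MemLp (X t) 2 P)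
    (hZ : IsGaussianWhiteNoise P Sig Z)
    (hVAR : SatisfiesVAR P c A X Z)
    (hstat : IsStationaryProcess P X)
    (hvar : ∀ t, varMatrix P (X t) = Om⁻¹) :
    IsCausalVAR A ↔
      ∀ᵐ ω ∂P,
        Om ≤ (condDispersion P X 1 ω)⁻¹ ∧
        (∀ j : ℕ, 1 ≤ j → j < p →
          (condDispersion P X j ω)⁻¹ ≤ (condDispersion P X (j + 1) ω)⁻¹) ∧
        (condDispersion P X p ω)⁻¹ = Sig⁻¹ := by
  obtain ⟨q, rfl⟩ : ∃ q, p = q + 1 := ⟨p - 1, by omega⟩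
  set x := centredLp hX2 with hxdef
  let z : ℤ → Fin d → Lp ℝ 2 P := fun t a => (hZ.memLp t a).toLp _
  have hx : ∀ t a, x t a =ᵐ[P] fun ω => X t ω a - ∫ ω, X 0 ω a ∂P := centredLp_ae_eq hX2
  have hst : ∀ s t a b, ⟪x (s + 1) a, x (t + 1) b⟫ = ⟪x s a, x t b⟫ :=
    hstat.inner_centredLp_succ hXm hX2
  have hrec : ∀ t a, x t a =
      ∑ i : Fin (q + 1), ∑ b, A i a b • x (t - ((i : ℕ) + 1 : ℤ)) b + z t a :=
    hVAR.centredLp_eq hstat hXm hX2 hZ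
  have hzz : ∀ t a b, ⟪z t a, z t b⟫ = Sig a b := fun t a b =>
    (inner_toLp_eq_integral _ _).trans (hZ.integral_mul hSig.posSemidef t a b)
  have hz0 : ∀ s t a b, s ≠ t → ⟪z s a, z t b⟫ = 0 := fun s t a b hne =>
    (inner_toLp_eq_integral _ _).trans (hZ.integral_mul_of_ne hne a b)
  constructor
  · intro hA
    have hbd := hstat.norm_centredLp_le hXm hX2
    have hxK : ∀ t a, x t a ∈ (Submodule.span ℝ
        (Set.range fun i : ℤ × Fin d => z i.1 i.2)).topologicalClosure := by
      intro t a
      -- The closed span is the double orthogonal complement, so it is enough to test against `h`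
      -- orthogonal to all innovations.
      rw [← Submodule.orthogonal_orthogonal_eq_closure, Submodule.mem_orthogonal']
      intro h hh
      rw [Submodule.mem_orthogonal] at hh
      exact hA.inner_eq_zero hrec hbd (T := t)
        (fun s _ b => hh _ (Submodule.subset_span ⟨(s, b), rfl⟩)) le_rfl a
    have hG : ∀ f ∈ Submodule.span ℝ (Set.range fun i : ℤ × Fin d => x i.1 i.2),
        HasGaussianLaw f P := by
      intro f hf
      refine hZ.hasGaussianLaw_of_mem_closure (Submodule.span_le.2 ?_ hf)
      rintro _ ⟨i, rfl⟩
      exact hxK _ _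
    have hD := condDispersion_ae_eq_residualGram hXm hx (hstat.integral_centredLp hXm hX2) hG
    have hDq : residualGram x (q + 1) = Sig :=
      residualGram_eq_of_isCausalVAR hA hrec hbd hzz hz0
    have hanti : Antitone (residualGram x) := antitone_nat_of_succ_le (residualGram_succ_le hst)
    have hpos : ∀ j ≤ q + 1, (residualGram x j).PosDef := by
      intro j hj
      have h1 := hanti hj
      rw [hDq] at h1
      have := hSig.add_posSemidef (Matrix.le_iff.1 h1)
      simpa using this
    have hinv : ∀ j, j < q + 1 → (residualGram x j)⁻¹ ≤ (residualGram x (j + 1))⁻¹ := fun j hj =>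
      (hpos (j + 1) hj).inv_le_inv_of_le (hanti (Nat.le_succ j))
    have h0 : residualGram x 0 = Om⁻¹ := by
      rw [residualGram_zero, ← hvar 1]
      ext a b
      rw [Matrix.of_apply, varMatrix, Matrix.of_apply, covariance, hxdef, inner_centredLp,
        hstat.integral_apply hXm 1 a, hstat.integral_apply hXm 1 b]
    filter_upwards [ae_all_iff.2 hD] with ω hω
    simp only [hω]
    refine ⟨?_, fun j _ hj => hinv j hj, by rw [hDq]⟩
    -- The first inequality of the chain is the monotonicity step from `j = 0`, where the prediction
    -- error is the centred value itself.
    have h1 := hinv 0 (by omega)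
    rwa [h0, Matrix.nonsing_inv_nonsing_inv _ ((Matrix.isUnit_iff_isUnit_det _).1 hOm.isUnit)] at h1
  · intro h
    have hC : ∀ᵐ ω ∂P, condDispersion P X (q + 1) ω = Sig := by
      filter_upwards [h] with ω hω
      -- Singular matrices have the default inverse `0`, so invertibility must be checked before
      -- inverses are cancelled.
      have h1 : IsUnit (condDispersion P X (q + 1) ω)⁻¹ := by
        rw [hω.2.2]
        exact hSig.inv.isUnit
      exact Matrix.inv_inj hω.2.2 ((Matrix.isUnit_iff_isUnit_det _).1
        (Matrix.isUnit_nonsing_inv_iff.1 h1))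
    refine isCausalVAR_of_inner_eq_zero hSig hrec hst hzz fun t a i b => ?_
    -- Orthogonality is known only at time `p + 1`. Since `z` is a fixed linear filter of `x`, its
    -- cross products with `x` are also shift invariant, which carries the orthogonality to every
    -- `t`.
    have hzx : ∀ s t a b, ⟪z (s + 1) a, x (t + 1) b⟫ = ⟪z s a, x t b⟫ := by
      intro s t a b
      have h1 : ∀ s, z s a =
          x s a - ∑ i : Fin (q + 1), ∑ b, A i a b • x (s - ((i : ℕ) + 1 : ℤ)) b := fun s => by
        rw [hrec s a]
        abel
      have h2 : ∀ i : Fin (q + 1), s + 1 - ((i : ℕ) + 1 : ℤ) = s - ((i : ℕ) + 1 : ℤ) + 1 :=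
        fun i => by ring
      simp only [h1, inner_sub_left, sum_inner, inner_smul_left, h2, hst]
    have hshift := eq_of_add_one_eq (f := fun t => ⟪z t a, x (t - ((i : ℕ) + 1 : ℤ)) b⟫)
      (fun t => by rw [← hzx t, show t + 1 - ((i : ℕ) + 1 : ℤ) = t - ((i : ℕ) + 1 : ℤ) + 1 by ring])
      t (((q + 1 : ℕ) : ℤ) + 1)
    refine hshift.trans ?_
    have hidx : ((q + 1 : ℕ) : ℤ) + 1 - ((i : ℕ) + 1 : ℤ) = ((Fin.rev i : ℕ) : ℤ) + 1 := by
      rw [Fin.val_rev]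
      omega
    simp only [hidx]
    exact hVAR.inner_eq_zero_of_condDispersion_eq hXm hX2 hZ hSig.posSemidef hC a (Fin.rev i) b
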